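/- Let $M\ge 1$ and let $\Sigma$ be the linear switched system $$\dot x(t)=A_{q(t)}x(t)+B_{q(t)}u(t),\qquad y(t)=C_{q(t)}x(t),$$ with $A_j\in\mathbb R^{n\times n}$, $B_j\in\mathbb R^{n\times m}$, $C_j\in\mathbb R^{p\times n}$ for $j\in\Omega=\{1,\dots,M\}$, where every $A_j$ is Hurwitz, the switching signal $q$ is piecewise constant with values in $\Omega$ (finitely many switches on bounded intervals) and the inputs $u$ are locally integrable. Let $\phi(t,x_0,u,q)$ be the state at time $t$ of the trajectory with $x(0)=x_0$. A state $x$ is reachable if $x=\phi(t_f,0,u,q)$ for some $t_f\ge 0$, switching signal $q$ and input $u$ on $[0,t_f]$; $\Sigma$ is completely reachable if every $x\in\mathbb R^n$ is reachable. A state $x$ is unobservable if for every switching signal $q$ there is an input $u$ with $C_{q(t)}\phi(t,x,u,q)=C_{q(t)}\phi(t,0,u,q)$ for all $t\ge 0$; $\Sigma$ is completely observable if the orthogonal complement of the set of unobservable states is $\mathbb R^n$. Put $A=A_1$ and $D_j=A_j-A_1$, and suppose that each of the generalized Lyapunov equations $$A\mathcal P+\mathcal PA^T+\sum_{j=1}^M\big(D_j\mathcal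 PD_j^T+B_jB_j^T\big)=0,\qquad A^T\mathcal Q+\mathcal QA+\sum_{j=1}^M\big(D_j^T\mathcal QD_j+C_j^TC_j\big)=0$$ has a unique symmetric positive semidefinite solution, $\mathcal P$ and $\mathcal Q$ respectively. Then 1. $\Sigma$ is completely reachable if and only if $\operatorname{range}\mathcal P=\mathbb R^n$; 2. $\Sigma$ is completely observable if and only if $\operatorname{range}\mathcal Q=\mathbb R^n$. -/

import Mathlib

open scoped Matrix

/-- The data of a continuous-time linear switched system with `M` modes,
`x'(t) = A_{q(t)} x(t) + B_{q(t)} u(t)`, `y(t) = C_{q(t)} x(t)`,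
with state space `ℝⁿ`, input space `ℝᵐ` and output space `ℝᵖ`.
The modes `1, …, M` are indexed by `Fin M`, so that the first mode is `0`. -/
structure LSS (M n m p : ℕ) where
  /-- state matrices -/
  A : Fin M → Matrix (Fin n) (Fin n) ℝ
  /-- input matrices -/
  B : Fin M → Matrix (Fin n) (Fin m) ℝ
  /-- output matrices -/
  C : Fin M → Matrix (Fin p) (Fin n) ℝ

/-- A real square matrix is Hurwitz if all its complex eigenvalues have negative real part. -/
def IsHurwitz {n : ℕ} (A : Matrix (Fin n) (Fin n) ℝ) : Prop :=
  ∀ μ ∈ spectrum ℂ (A.map (algebraMap ℝ ℂ)), μ.re < 0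

/-- `q` is piecewise constant on `[0, T]`: there are finitely many exceptional times such that
`q` does not change along any subinterval of `[0, T]` that contains none of them. -/
def IsSwitchingSignalOn {M : ℕ} (q : ℝ → Fin M) (T : ℝ) : Prop :=
  ∃ F : Finset ℝ, ∀ s t : ℝ, 0 ≤ s → s ≤ t → t ≤ T →
    (∀ r ∈ F, r ∉ Set.Icc s t) → q s = q t

/-- A switching signal on `[0, ∞)`: finitely many switches on every bounded interval. -/
def IsSwitchingSignal {M : ℕ} (q : ℝ → Fin M) : Prop :=
  ∀ T : ℝ, 0 ≤ T → IsSwitchingSignalOn q T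

/-- An admissible input on `[0, T]`: an integrable function. -/
def IsInputOn {m : ℕ} (u : ℝ → Fin m → ℝ) (T : ℝ) : Prop :=
  MeasureTheory.IntegrableOn u (Set.Icc 0 T) MeasureTheory.volume

/-- An admissible input on `[0, ∞)`: a locally integrable function. -/
def IsInput {m : ℕ} (u : ℝ → Fin m → ℝ) : Prop :=
  ∀ T : ℝ, 0 ≤ T → IsInputOn u T

namespace LSS

variable {M n m p : ℕ}

/-- `x` is the state trajectory `t ↦ φ(t, x₀, u, q)` on `[0, T]`: the continuous solution, in the
sense of Carathéodory, of `x' = A_{q} x + B_{q} u`, `x(0) = x₀`. -/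
def IsTrajectoryOn (S : LSS M n m p) (x₀ : Fin n → ℝ) (u : ℝ → Fin m → ℝ) (q : ℝ → Fin M)
    (x : ℝ → Fin n → ℝ) (T : ℝ) : Prop :=
  ContinuousOn x (Set.Icc 0 T) ∧
    ∀ t ∈ Set.Icc 0 T,
      x t = x₀ + ∫ s in (0 : ℝ)..t, (S.A (q s) *ᵥ x s + S.B (q s) *ᵥ u s)

/-- `x` is the state trajectory `t ↦ φ(t, x₀, u, q)` on `[0, ∞)`. -/
def IsTrajectory (S : LSS M n m p) (x₀ : Fin n → ℝ) (u : ℝ → Fin m → ℝ) (q : ℝ → Fin M)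
    (x : ℝ → Fin n → ℝ) : Prop :=
  ∀ T : ℝ, 0 ≤ T → S.IsTrajectoryOn x₀ u q x T

/-- The reachable set: all states `φ(t_f, 0, u, q)` for some time `t_f`, some switching signal
`q` on `[0, t_f]` and some input `u` on `[0, t_f]`. -/
def reachableSet (S : LSS M n m p) : Set (Fin n → ℝ) :=
  {ξ | ∃ tf : ℝ, 0 ≤ tf ∧ ∃ q : ℝ → Fin M, IsSwitchingSignalOn q tf ∧
    ∃ u : ℝ → Fin m → ℝ, IsInputOn u tf ∧
    ∃ x : ℝ → Fin n → ℝ, S.IsTrajectoryOn 0 u q x tf ∧ x tf = ξ}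

/-- The unobservable set: all states `ξ` such that for every switching signal `q` there is an
input `u` with `C_{q(t)} φ(t, ξ, u, q) = C_{q(t)} φ(t, 0, u, q)` for all `t ≥ 0`. -/
def unobservableSet (S : LSS M n m p) : Set (Fin n → ℝ) :=
  {ξ | ∀ q : ℝ → Fin M, IsSwitchingSignal q →
    ∃ u : ℝ → Fin m → ℝ, IsInput u ∧
    ∃ x z : ℝ → Fin n → ℝ, S.IsTrajectory ξ u q x ∧ S.IsTrajectory 0 u q z ∧
      ∀ t : ℝ, 0 ≤ t → S.C (q t) *ᵥ x t = S.C (q t) *ᵥ z t}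

/-- The observable set: the orthogonal complement of the unobservable set. -/
def observableSet (S : LSS M n m p) : Set (Fin n → ℝ) :=
  {η | ∀ ξ ∈ S.unobservableSet, ξ ⬝ᵥ η = 0}

/-- Complete reachability: every state is reachable. -/
def CompletelyReachable (S : LSS M n m p) : Prop :=
  S.reachableSet = Set.univ

/-- Complete observability: the observable set is the whole state space. -/
def CompletelyObservable (S : LSS M n m p) : Prop :=
  S.observableSet = Set.univ

/-- `D_j = A_j - A_1`. -/
def D [NeZero M] (S : LSS M n m p) (j : Fin M) : Matrix (Fin n) (Fin n) ℝ :=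
  S.A j - S.A 0

/-- The generalized reachability Lyapunov equation, with `A = A_1`:
`A P + P Aᵀ + ∑ⱼ (Dⱼ P Dⱼᵀ + Bⱼ Bⱼᵀ) = 0`. -/
def ReachLyapunov [NeZero M] (S : LSS M n m p) (P : Matrix (Fin n) (Fin n) ℝ) : Prop :=
  S.A 0 * P + P * (S.A 0)ᵀ + ∑ j, (S.D j * P * (S.D j)ᵀ + S.B j * (S.B j)ᵀ) = 0

/-- The generalized observability Lyapunov equation, with `A = A_1`:
`Aᵀ Q + Q A + ∑ⱼ (Dⱼᵀ Q Dⱼ + Cⱼᵀ Cⱼ) = 0`. -/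
def ObsLyapunov [NeZero M] (S : LSS M n m p) (Q : Matrix (Fin n) (Fin n) ℝ) : Prop :=
  (S.A 0)ᵀ * Q + Q * S.A 0 + ∑ j, ((S.D j)ᵀ * Q * S.D j + (S.C j)ᵀ * S.C j) = 0

end LSS

/-- `P` is the unique (symmetric) positive semidefinite matrix satisfying the equation `E`. -/
def IsUniquePosSemidefSolution {n : ℕ} (E : Matrix (Fin n) (Fin n) ℝ → Prop)
    (P : Matrix (Fin n) (Fin n) ℝ) : Prop :=
  (P.PosSemidef ∧ E P) ∧ ∀ X : Matrix (Fin n) (Fin n) ℝ, X.PosSemidef → E X → X = P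

/-! Evaluating the quadratic form of the reachability equation at a kernel vector of `P` leaves a
vanishing sum of nonnegative terms. Hence `ker P` is invariant under every `(A j)ᵀ` and killed by
every `(B j)ᵀ` (`ReachLyapunov.ker_invariant`), trajectories from the origin stay orthogonal to `ker
P`, and complete reachability forces `ker P = 0`.

Conversely, let `P` be nonsingular, hence positive definite. Small symmetric perturbations of `P`
stay positive semidefinite, so uniqueness makes the Lyapunov operator injective on symmetric
matrices. If `V` is invariant under all `A j` and contains the ranges of all `B j`, the operator
preserves the symmetric matrices with range in `V`. By finite dimension it is bijective there, so
`P` is one of them and `V` is everything (`eq_top_of_invariant`). This applies to a `V` made of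
reachable states, the intersection of all jointly reachable subspaces of maximal dimension
(`exists_isJointlyReachable_invariant`).

For observability the same algebra is applied to the dual system: `ker Q` consists of unobservable
states, and the orthogonal complement of the unobservable set is such a `V` for `dual`. -/

namespace LSS

variable {M n m p : ℕ}

/-! ### Algebra of the generalized Lyapunov equation -/

/-- The dual system. -/
def dual (S : LSS M n m p) : LSS M n p m where
  A j := (S.A j)ᵀ
  B j := (S.C j)ᵀ
  C j := (S.B j)ᵀ

lemma obsLyapunov_iff_dual [NeZero M] (S : LSS M n m p) (Q : Matrix (Fin n) (Fin n) ℝ) :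
    S.ObsLyapunov Q ↔ S.dual.ReachLyapunov Q := by
  simp [ObsLyapunov, ReachLyapunov, dual, D, Matrix.transpose_sub]

/-- The homogeneous part of the generalized Lyapunov equation, as a linear operator. -/
def lyapunovOp [NeZero M] (S : LSS M n m p) :
    Matrix (Fin n) (Fin n) ℝ →ₗ[ℝ] Matrix (Fin n) (Fin n) ℝ where
  toFun X := S.A 0 * X + X * (S.A 0)ᵀ + ∑ j, S.D j * X * (S.D j)ᵀ
  map_add' X Y := by
    simp only [Matrix.mul_add, Matrix.add_mul, Finset.sum_add_distrib]
    abel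
  map_smul' c X := by
    simp [Finset.smul_sum, smul_add]

lemma lyapunovOp_apply [NeZero M] (S : LSS M n m p) (X : Matrix (Fin n) (Fin n) ℝ) :
    S.lyapunovOp X = S.A 0 * X + X * (S.A 0)ᵀ + ∑ j, S.D j * X * (S.D j)ᵀ := rfl

lemma reachLyapunov_iff [NeZero M] (S : LSS M n m p) (X : Matrix (Fin n) (Fin n) ℝ) :
    S.ReachLyapunov X ↔ S.lyapunovOp X = -∑ j, S.B j * (S.B j)ᵀ := by
  rw [ReachLyapunov, lyapunovOp_apply, Finset.sum_add_distrib, ← add_assoc, add_eq_zero_iff_eq_neg]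

/-- The kernel of a positive semidefinite solution of the reachability Lyapunov equation is
invariant under all `Aⱼᵀ` and contained in the kernels of all `Bⱼᵀ`. -/
lemma ReachLyapunov.ker_invariant [NeZero M] {S : LSS M n m p} {P : Matrix (Fin n) (Fin n) ℝ}
    (hP : P.PosSemidef) (h : S.ReachLyapunov P) {w : Fin n → ℝ} (hw : P *ᵥ w = 0) (j : Fin M) :
    P *ᵥ ((S.A j)ᵀ *ᵥ w) = 0 ∧ (S.B j)ᵀ *ᵥ w = 0 := by
  have hsymm : Pᵀ = P := by simpa using hP.isHermitian.eq
  have hwP : w ᵥ* P = 0 := by rw [← Matrix.mulVec_transpose, hsymm, hw]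
  have hnn : ∀ v : Fin n → ℝ, 0 ≤ v ⬝ᵥ (P *ᵥ v) := fun v => by
    simpa using hP.dotProduct_mulVec_nonneg v
  -- The equation tested with `w` on both sides: the terms with `A 0` vanish because `P *ᵥ w = 0`
  -- and `w ᵥ* P = 0`.
  have key : ∑ j, (((S.D j)ᵀ *ᵥ w) ⬝ᵥ (P *ᵥ ((S.D j)ᵀ *ᵥ w)) +
      ((S.B j)ᵀ *ᵥ w) ⬝ᵥ ((S.B j)ᵀ *ᵥ w)) = 0 := by
    have h1 := congrArg (fun X => w ⬝ᵥ (X *ᵥ w)) h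
    simp only [Matrix.add_mulVec, Matrix.sum_mulVec, ← Matrix.mulVec_mulVec, hw,
      Matrix.mulVec_zero, dotProduct_add, dotProduct_sum, Matrix.zero_mulVec, dotProduct_zero,
      Matrix.dotProduct_mulVec w P, hwP, zero_dotProduct, zero_add] at h1
    rw [← h1]
    refine Finset.sum_congr rfl fun j _ => ?_
    rw [Matrix.dotProduct_mulVec w (S.D j), Matrix.dotProduct_mulVec w (S.B j),
      ← Matrix.mulVec_transpose, ← Matrix.mulVec_transpose]
  have hterm := (Finset.sum_eq_zero_iff_of_nonneg (fun j _ =>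
    add_nonneg (hnn _) (by exact Finset.sum_nonneg fun i _ => mul_self_nonneg _))).1 key
  have hD : ∀ j, P *ᵥ ((S.D j)ᵀ *ᵥ w) = 0 ∧ (S.B j)ᵀ *ᵥ w = 0 := by
    intro j
    have hB : 0 ≤ ((S.B j)ᵀ *ᵥ w) ⬝ᵥ ((S.B j)ᵀ *ᵥ w) :=
      Finset.sum_nonneg fun i _ => mul_self_nonneg _
    have := hterm j (Finset.mem_univ j)
    have hB0 : ((S.B j)ᵀ *ᵥ w) ⬝ᵥ ((S.B j)ᵀ *ᵥ w) = 0 := by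
      linarith [hnn ((S.D j)ᵀ *ᵥ w)]
    refine ⟨?_, dotProduct_self_eq_zero.1 hB0⟩
    have h0 : star ((S.D j)ᵀ *ᵥ w) ⬝ᵥ (P *ᵥ ((S.D j)ᵀ *ᵥ w)) = 0 := by
      simp only [star_trivial]; linarith [hnn ((S.D j)ᵀ *ᵥ w)]
    exact (hP.dotProduct_mulVec_zero_iff _).1 h0
  -- Now the equation is applied to `w` as a vector: every other term is already known to vanish.
  have hA0 : P *ᵥ ((S.A 0)ᵀ *ᵥ w) = 0 := by
    have h1 := congrArg (fun X => X *ᵥ w) h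
    simpa [Matrix.add_mulVec, Matrix.sum_mulVec, ← Matrix.mulVec_mulVec, hw, hD] using h1
  refine ⟨?_, (hD j).2⟩
  have h2 := (hD j).1
  rw [D, Matrix.transpose_sub, Matrix.sub_mulVec, Matrix.mulVec_sub, hA0, sub_zero] at h2
  exact h2

end LSS

/-- A positive definite matrix stays positive semidefinite under small symmetric perturbations. -/
lemma Matrix.PosDef.exists_add_smul_posSemidef {n : ℕ} {P H : Matrix (Fin n) (Fin n) ℝ}
    (hP : P.PosDef) (hH : H.IsHermitian) : ∃ ε : ℝ, 0 < ε ∧ (P + ε • H).PosSemidef := by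
  have hcont : ∀ X : Matrix (Fin n) (Fin n) ℝ, Continuous fun v : Fin n → ℝ => v ⬝ᵥ (X *ᵥ v) :=
    fun X => by fun_prop
  have hK : IsCompact (Metric.sphere (0 : Fin n → ℝ) 1) := isCompact_sphere 0 1
  have hpos : ∀ v : Fin n → ℝ, v ≠ 0 → 0 < v ⬝ᵥ (P *ᵥ v) := fun v hv => by
    simpa using hP.dotProduct_mulVec_pos hv
  obtain ⟨ε, hε, hsph⟩ : ∃ ε : ℝ, 0 < ε ∧ ∀ v ∈ Metric.sphere (0 : Fin n → ℝ) 1,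
      0 ≤ v ⬝ᵥ (P *ᵥ v) + ε * (v ⬝ᵥ (H *ᵥ v)) := by
    rcases (Metric.sphere (0 : Fin n → ℝ) 1).eq_empty_or_nonempty with he | hne
    · exact ⟨1, one_pos, by simp [he]⟩
    obtain ⟨v₀, hv₀, hmin⟩ := hK.exists_isMinOn hne (hcont P).continuousOn
    obtain ⟨b, hb⟩ := hK.exists_bound_of_continuousOn (hcont H).continuousOn
    have hc : 0 < v₀ ⬝ᵥ (P *ᵥ v₀) := hpos v₀
      (ne_zero_of_mem_unit_sphere (⟨v₀, hv₀⟩ : Metric.sphere (0 : Fin n → ℝ) 1))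
    set c := v₀ ⬝ᵥ (P *ᵥ v₀)
    have hb' : 0 < |b| + 1 := by positivity
    -- On the unit sphere the form of `P` is at least `c` and that of `H` is at most `|b|` in
    -- absolute value; the `+ 1` keeps the denominator positive.
    refine ⟨c / (|b| + 1), by positivity, fun v hv => ?_⟩
    have h1 : c ≤ v ⬝ᵥ (P *ᵥ v) := hmin hv
    have h2 : |v ⬝ᵥ (H *ᵥ v)| ≤ |b| + 1 := by
      have := hb v hv
      rw [Real.norm_eq_abs] at this
      linarith [le_abs_self b]
    have h3 : -c ≤ c / (|b| + 1) * (v ⬝ᵥ (H *ᵥ v)) := by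
      have : c / (|b| + 1) * (-(|b| + 1)) ≤ c / (|b| + 1) * (v ⬝ᵥ (H *ᵥ v)) :=
        mul_le_mul_of_nonneg_left (abs_le.1 h2).1 (by positivity)
      calc -c = c / (|b| + 1) * (-(|b| + 1)) := by field_simp
        _ ≤ _ := this
    linarith
  refine ⟨ε, hε, Matrix.PosSemidef.of_dotProduct_mulVec_nonneg ?_ fun v => ?_⟩
  · exact hP.isHermitian.add (hH.smul (IsSelfAdjoint.all ε))
  · rcases eq_or_ne v 0 with rfl | hv
    · simp
    have hv' : ‖v‖ ≠ 0 := norm_ne_zero_iff.2 hv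
    have := hsph (‖v‖⁻¹ • v) (by simp [norm_smul, hv'])
    simp only [Matrix.mulVec_smul, smul_dotProduct, dotProduct_smul, smul_eq_mul] at this
    simp only [star_trivial, Matrix.add_mulVec, dotProduct_add, Matrix.smul_mulVec,
      dotProduct_smul, smul_eq_mul]
    have h5 := mul_nonneg (mul_self_nonneg ‖v‖) this
    calc (0 : ℝ) ≤ _ := h5
      _ = _ := by field_simp

namespace LSS

variable {M n m p : ℕ}

lemma lyapunovOp_transpose [NeZero M] (S : LSS M n m p) {X : Matrix (Fin n) (Fin n) ℝ}
    (hX : Xᵀ = X) : (S.lyapunovOp X)ᵀ = S.lyapunovOp X := by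
  simp [lyapunovOp_apply, Matrix.transpose_add, Matrix.transpose_mul, hX, Matrix.transpose_sum,
    Matrix.mul_assoc, add_comm]

/-- The symmetric matrices whose range lies in the subspace `V`. -/
def symmetricInto (V : Submodule ℝ (Fin n → ℝ)) : Submodule ℝ (Matrix (Fin n) (Fin n) ℝ) where
  carrier := {X | Xᵀ = X ∧ ∀ w, X *ᵥ w ∈ V}
  add_mem' := fun {X Y} hX hY => ⟨by rw [Matrix.transpose_add, hX.1, hY.1], fun w => by
    rw [Matrix.add_mulVec]; exact V.add_mem (hX.2 w) (hY.2 w)⟩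
  zero_mem' := ⟨by simp, fun w => by simp⟩
  smul_mem' := fun c X hX => ⟨by rw [Matrix.transpose_smul, hX.1], fun w => by
    rw [Matrix.smul_mulVec]; exact V.smul_mem c (hX.2 w)⟩

/-- If the reachability Lyapunov equation has a unique positive semidefinite solution and this
solution is nonsingular, then no proper subspace is invariant under all `Aⱼ` and contains the
ranges of all `Bⱼ`. -/
lemma eq_top_of_invariant [NeZero M] {S : LSS M n m p} {P : Matrix (Fin n) (Fin n) ℝ}
    (hP : IsUniquePosSemidefSolution S.ReachLyapunov P) (hker : ∀ w, P *ᵥ w = 0 → w = 0)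
    (V : Submodule ℝ (Fin n → ℝ)) (hA : ∀ j, ∀ v ∈ V, S.A j *ᵥ v ∈ V)
    (hB : ∀ j v, S.B j *ᵥ v ∈ V) : V = ⊤ := by
  obtain ⟨⟨hPpsd, hPeq⟩, huniq⟩ := hP
  have hsymm : Pᵀ = P := by simpa using hPpsd.isHermitian.eq
  have hPD : P.PosDef := by
    refine Matrix.PosDef.of_dotProduct_mulVec_pos hPpsd.isHermitian fun v hv => ?_
    refine lt_of_le_of_ne (hPpsd.dotProduct_mulVec_nonneg v) fun h => hv (hker v ?_)
    exact (hPpsd.dotProduct_mulVec_zero_iff v).1 h.symm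
  -- For `H` in the kernel, `P + ε • H` solves the same equation and is positive semidefinite for
  -- some `ε > 0`, so it equals `P`.
  have hinj : ∀ H : Matrix (Fin n) (Fin n) ℝ, Hᵀ = H → S.lyapunovOp H = 0 → H = 0 := by
    intro H hH h0
    obtain ⟨ε, hε, hpsd⟩ := hPD.exists_add_smul_posSemidef (H := H)
      (by rw [Matrix.IsHermitian, Matrix.conjTranspose_eq_transpose_of_trivial, hH])
    have := huniq _ hpsd (by
      rw [reachLyapunov_iff, map_add, map_smul, h0, smul_zero, add_zero]
      exact (S.reachLyapunov_iff P).1 hPeq)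
    have h2 : ε • H = 0 := by simpa using this
    exact (smul_eq_zero.1 h2).resolve_left hε.ne'
  have hD : ∀ j, ∀ v ∈ V, S.D j *ᵥ v ∈ V := fun j v hv => by
    rw [D, Matrix.sub_mulVec]; exact V.sub_mem (hA j v hv) (hA 0 v hv)
  -- Only the leftmost factor of a product matters for its range, so `X * (S.A 0)ᵀ` needs no
  -- invariance under the transpose.
  have hmaps : ∀ X ∈ symmetricInto V, S.lyapunovOp X ∈ symmetricInto V := by
    rintro X ⟨hXt, hXV⟩
    refine ⟨S.lyapunovOp_transpose hXt, fun w => ?_⟩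
    simp only [lyapunovOp_apply, Matrix.add_mulVec, Matrix.sum_mulVec, ← Matrix.mulVec_mulVec]
    exact V.add_mem (V.add_mem (hA 0 _ (hXV _)) (hXV _)) (V.sum_mem fun j _ => hD j _ (hXV _))
  let T := S.lyapunovOp.restrict hmaps
  have hTinj : Function.Injective T := by
    rw [injective_iff_map_eq_zero]
    intro X hX
    exact Subtype.ext (hinj X.1 X.2.1 (congrArg Subtype.val hX))
  have hTsurj : Function.Surjective T := LinearMap.injective_iff_surjective.1 hTinj
  have hR : -∑ j, S.B j * (S.B j)ᵀ ∈ symmetricInto V := by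
    refine ⟨by simp [Matrix.transpose_sum, Matrix.transpose_mul], fun w => ?_⟩
    simp only [Matrix.neg_mulVec, Matrix.sum_mulVec, ← Matrix.mulVec_mulVec]
    exact V.neg_mem (V.sum_mem fun j _ => hB j _)
  obtain ⟨X, hX⟩ := hTsurj ⟨_, hR⟩
  have hX' : S.lyapunovOp X.1 = -∑ j, S.B j * (S.B j)ᵀ := congrArg Subtype.val hX
  have hPX : P - X.1 = 0 := by
    refine hinj _ (by rw [Matrix.transpose_sub, hsymm, X.2.1]) ?_
    rw [map_sub, hX', (S.reachLyapunov_iff P).1 hPeq, sub_self]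
  have hinjP : Function.Injective P.mulVecLin :=
    (injective_iff_map_eq_zero _).2 fun w hw => hker w hw
  refine eq_top_iff.2 fun v _ => ?_
  obtain ⟨w, rfl⟩ := LinearMap.injective_iff_surjective.1 hinjP v
  rw [Matrix.mulVecLin_apply, sub_eq_zero.1 hPX]
  exact X.2.2 w

end LSS

/-! ### Switching signals, concatenation in time, and an integral estimate -/

open Set MeasureTheory

lemma IsSwitchingSignalOn.mono {M : ℕ} {q : ℝ → Fin M} {T T' : ℝ} (hq : IsSwitchingSignalOn q T)
    (h : T' ≤ T) : IsSwitchingSignalOn q T' := by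
  obtain ⟨F, hF⟩ := hq
  exact ⟨F, fun s t hs hst ht => hF s t hs hst (ht.trans h)⟩

lemma isSwitchingSignalOn_const {M : ℕ} (j : Fin M) (T : ℝ) :
    IsSwitchingSignalOn (fun _ => j) T :=
  ⟨∅, fun _ _ _ _ _ _ => rfl⟩

/-- A function assembled from finitely many integrable functions along a switching signal is
integrable. -/
lemma IsSwitchingSignalOn.integrableOn {M : ℕ} {E : Type*} [NormedAddCommGroup E]
    {q : ℝ → Fin M} {T : ℝ} (hq : IsSwitchingSignalOn q T) {g : Fin M → ℝ → E}
    (hg : ∀ j, IntegrableOn (g j) (Icc 0 T)) : IntegrableOn (fun s => g (q s) s) (Icc 0 T) := by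
  obtain ⟨F, hF⟩ := hq
  have hO : IsOpen (Ioo 0 T \ (F : Set ℝ)) := isOpen_Ioo.sdiff F.finite_toSet.isClosed
  -- Off the finite set `F` the signal is locally constant, so its level sets are open; this
  -- supplies the measurability of `q`.
  have hU : ∀ j, IsOpen {s | s ∈ Ioo 0 T \ (F : Set ℝ) ∧ q s = j} := by
    refine fun j => Metric.isOpen_iff.2 fun s ⟨hs, hqs⟩ => ?_
    obtain ⟨ε, hε, hball⟩ := Metric.isOpen_iff.1 hO s hs
    refine ⟨ε, hε, fun t ht => ⟨hball ht, ?_⟩⟩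
    have hconv : OrdConnected (Metric.ball s ε) := (convex_ball s ε).ordConnected
    have hs' := Metric.mem_ball_self (x := s) hε
    rcases le_total s t with hst | hst
    · rw [← hqs]
      refine (hF s t hs.1.1.le hst (hball ht).1.2.le fun r hr hr' => ?_).symm
      exact (hball (hconv.out hs' ht hr')).2 hr
    · rw [← hqs]
      refine hF t s (hball ht).1.1.le hst hs.1.2.le fun r hr hr' => ?_
      exact (hball (hconv.out ht hs' hr')).2 hr
  have hae : (⋃ j, {s | s ∈ Ioo 0 T \ (F : Set ℝ) ∧ q s = j}) =ᵐ[volume] Icc 0 T := by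
    have : (⋃ j, {s | s ∈ Ioo 0 T \ (F : Set ℝ) ∧ q s = j}) = Ioo 0 T \ (F : Set ℝ) := by
      ext s; simp
    rw [this]
    exact (sdiff_null_ae_eq_self (F.finite_toSet.measure_zero volume)).trans Ioo_ae_eq_Icc
  refine IntegrableOn.congr_set_ae ?_ hae.symm
  refine (integrableOn_finite_iUnion).2 fun j => ?_
  refine IntegrableOn.congr_fun ((hg j).mono_set fun s hs => Ioo_subset_Icc_self hs.1.1) ?_
    (hU j).measurableSet
  rintro s ⟨-, hs⟩
  simp only [hs]

/-- Follow `f` up to time `T`, then `g`, restarted at time `T`. -/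
noncomputable def concatAt {α : Type*} (T : ℝ) (f g : ℝ → α) : ℝ → α :=
  fun s => if s < T then f s else g (s - T)

lemma concatAt_of_lt {α : Type*} {T s : ℝ} (f g : ℝ → α) (h : s < T) : concatAt T f g s = f s :=
  if_pos h

lemma concatAt_of_le {α : Type*} {T s : ℝ} (f g : ℝ → α) (h : T ≤ s) :
    concatAt T f g s = g (s - T) :=
  if_neg h.not_gt

lemma IsSwitchingSignalOn.concatAt {M : ℕ} {q r : ℝ → Fin M} {T τ : ℝ}
    (hq : IsSwitchingSignalOn q T) (hr : IsSwitchingSignalOn r τ) :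
    IsSwitchingSignalOn (concatAt T q r) (T + τ) := by
  classical
  obtain ⟨F, hF⟩ := hq
  obtain ⟨G, hG⟩ := hr
  -- With the junction `T` exceptional, an admissible interval lies entirely on one side of it.
  refine ⟨insert T (F ∪ G.image (· + T)), fun s t hs hst ht h => ?_⟩
  have hT : ¬ (s ≤ T ∧ T ≤ t) := h T (by simp)
  rcases lt_or_ge t T with htT | htT
  · rw [concatAt_of_lt _ _ htT, concatAt_of_lt _ _ (hst.trans_lt htT)]
    exact hF s t hs hst htT.le fun x hx => h x (by simp [hx])
  · have hsT : T < s := by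
      by_contra hc
      exact hT ⟨not_lt.1 hc, htT⟩
    rw [concatAt_of_le _ _ htT, concatAt_of_le _ _ hsT.le]
    refine hG _ _ (by linarith) (by linarith) (by linarith) fun x hx hx' => ?_
    exact h (x + T) (by simp [hx]) ⟨by linarith [hx'.1], by linarith [hx'.2]⟩

lemma IsInputOn.concatAt {m : ℕ} {u v : ℝ → Fin m → ℝ} {T τ : ℝ}
    (hu : IsInputOn u T) (hv : IsInputOn v τ) : IsInputOn (concatAt T u v) (T + τ) := by
  have hsplit : Icc 0 (T + τ) ⊆ Ico 0 T ∪ Icc T (T + τ) := fun s hs => by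
    rcases lt_or_ge s T with h | h
    · exact Or.inl ⟨hs.1, h⟩
    · exact Or.inr ⟨h, hs.2⟩
  refine IntegrableOn.mono_set (IntegrableOn.union ?_ ?_) hsplit
  · exact IntegrableOn.congr_fun (hu.mono_set Ico_subset_Icc_self)
      (fun s hs => (concatAt_of_lt _ _ hs.2).symm) measurableSet_Ico
  · have h1 : IntegrableOn (fun s => v (s - T)) (Icc T (T + τ)) := by
      have h2 := (measurePreserving_sub_right volume T).integrableOn_comp_preimage
        (MeasurableEquiv.subRight T).measurableEmbedding (f := v) (s := Icc 0 τ)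
      have h3 : (fun x : ℝ => x - T) ⁻¹' Icc 0 τ = Icc T (T + τ) := by
        simp [add_comm]
      rw [h3] at h2
      exact h2.2 hv
    exact h1.congr_fun (fun s hs => (concatAt_of_le _ _ hs.1).symm) measurableSet_Icc

lemma exists_mulVec_bound {M n : ℕ} (A : Fin M → Matrix (Fin n) (Fin n) ℝ) :
    ∃ K : ℝ, 0 ≤ K ∧ ∀ j v, ‖A j *ᵥ v‖ ≤ K * ‖v‖ := by
  let a : Fin M → ((Fin n → ℝ) →L[ℝ] (Fin n → ℝ)) := fun j => (A j).mulVecLin.toContinuousLinearMap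
  refine ⟨∑ j, ‖a j‖, Finset.sum_nonneg fun j _ => norm_nonneg _, fun j v => ?_⟩
  refine ((a j).le_opNorm v).trans (mul_le_mul_of_nonneg_right ?_ (norm_nonneg v))
  exact Finset.single_le_sum (f := fun j => ‖a j‖) (fun j _ => norm_nonneg _) (Finset.mem_univ j)

/-- One step of the iterated integral estimate. -/
lemma norm_integral_le_pow_succ {E : Type*} [NormedAddCommGroup E] [NormedSpace ℝ E]
    {g : ℝ → E} {c K t : ℝ} {k : ℕ} (ht : 0 ≤ t)
    (hg : ∀ s ∈ Icc 0 t, ‖g s‖ ≤ K * (c * ((K * s) ^ k / k.factorial))) :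
    ‖∫ s in (0 : ℝ)..t, g s‖ ≤ c * ((K * t) ^ (k + 1) / (k + 1).factorial) := by
  have h1 : ‖∫ s in (0 : ℝ)..t, g s‖ ≤
      ∫ s in (0 : ℝ)..t, K * (c * ((K * s) ^ k / k.factorial)) := by
    refine intervalIntegral.norm_integral_le_of_norm_le ht ?_ ?_
    · exact Filter.Eventually.of_forall fun s hs => hg s (Ioc_subset_Icc_self hs)
    · exact Continuous.intervalIntegrable (by fun_prop) _ _
  refine h1.trans (le_of_eq ?_)
  have h2 : ∀ s : ℝ, K * (c * ((K * s) ^ k / k.factorial)) =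
      (c * K ^ (k + 1) / k.factorial) * s ^ k := fun s => by
    rw [mul_pow, pow_succ]; ring
  simp_rw [h2]
  rw [intervalIntegral.integral_const_mul, integral_pow, Nat.factorial_succ, mul_pow]
  have : (k.factorial : ℝ) ≠ 0 := by positivity
  push_cast
  field_simp
  simp

/-! ### Trajectories: invariance, uniqueness, shift and concatenation -/

namespace LSS

variable {M n m p : ℕ}

lemma integrableOn_mulVec {q : ℝ → Fin M} {T : ℝ} (hq : IsSwitchingSignalOn q T) {k l : ℕ}
    (B : Fin M → Matrix (Fin k) (Fin l) ℝ) {u : ℝ → Fin l → ℝ} (hu : IntegrableOn u (Icc 0 T)) :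
    IntegrableOn (fun s => B (q s) *ᵥ u s) (Icc 0 T) :=
  hq.integrableOn (g := fun j s => B j *ᵥ u s)
    fun j => (B j).mulVecLin.toContinuousLinearMap.integrable_comp hu

lemma intervalIntegrable_field (S : LSS M n m p) {u : ℝ → Fin m → ℝ} {q : ℝ → Fin M}
    {x : ℝ → Fin n → ℝ} {T : ℝ} (hq : IsSwitchingSignalOn q T) (hu : IsInputOn u T)
    (hx : ContinuousOn x (Icc 0 T)) {s t : ℝ} (hs : s ∈ Icc 0 T) (ht : t ∈ Icc 0 T) :
    IntervalIntegrable (fun s => S.A (q s) *ᵥ x s + S.B (q s) *ᵥ u s) volume s t := by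
  have h := (integrableOn_mulVec hq S.A (hx.integrableOn_Icc)).add (integrableOn_mulVec hq S.B hu)
  refine IntegrableOn.intervalIntegrable (h.mono_set ?_)
  exact OrdConnected.uIcc_subset ordConnected_Icc hs ht

lemma isInputOn_const (v : Fin m → ℝ) (T : ℝ) : IsInputOn (fun _ => v) T :=
  continuous_const.integrableOn_Icc

lemma IsTrajectoryOn.apply_zero {S : LSS M n m p} {x₀ : Fin n → ℝ} {u : ℝ → Fin m → ℝ}
    {q : ℝ → Fin M} {x : ℝ → Fin n → ℝ} {T : ℝ} (hT : 0 ≤ T) (h : S.IsTrajectoryOn x₀ u q x T) :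
    x 0 = x₀ := by
  simpa using h.2 0 ⟨le_rfl, hT⟩

lemma IsTrajectoryOn.sub {S : LSS M n m p} {x₀ y₀ : Fin n → ℝ} {u v : ℝ → Fin m → ℝ}
    {q : ℝ → Fin M} {x y : ℝ → Fin n → ℝ} {T : ℝ} (hq : IsSwitchingSignalOn q T)
    (hu : IsInputOn u T) (hv : IsInputOn v T) (hx : S.IsTrajectoryOn x₀ u q x T)
    (hy : S.IsTrajectoryOn y₀ v q y T) :
    S.IsTrajectoryOn (x₀ - y₀) (fun s => u s - v s) q (fun s => x s - y s) T := by
  refine ⟨hx.1.sub hy.1, fun t ht => ?_⟩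
  have h0 : (0 : ℝ) ∈ Icc 0 T := ⟨le_rfl, ht.1.trans ht.2⟩
  have h1 := S.intervalIntegrable_field hq hu hx.1 h0 ht
  have h2 := S.intervalIntegrable_field hq hv hy.1 h0 ht
  have h3 := intervalIntegral.integral_sub h1 h2
  simp only [Matrix.mulVec_sub]
  rw [hx.2 t ht, hy.2 t ht, add_sub_add_comm, ← h3]
  congr 2
  ext1 s
  abel

/-- A trajectory that is driven only along an invariant subspace stays in that subspace. -/
lemma IsTrajectoryOn.mem_of_invariant {S : LSS M n m p} {x₀ : Fin n → ℝ} {u : ℝ → Fin m → ℝ}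
    {q : ℝ → Fin M} {x : ℝ → Fin n → ℝ} {T : ℝ} (hq : IsSwitchingSignalOn q T)
    (hu : IsInputOn u T) (hx : S.IsTrajectoryOn x₀ u q x T) {V : Submodule ℝ (Fin n → ℝ)}
    (hA : ∀ j, ∀ v ∈ V, S.A j *ᵥ v ∈ V) (hB : ∀ s, S.B (q s) *ᵥ u s ∈ V) (hx₀ : x₀ ∈ V)
    {t : ℝ} (ht : t ∈ Icc 0 T) : x t ∈ V := by
  obtain ⟨W, hW⟩ := V.exists_isCompl
  -- The projection onto `W` along `V`: its kernel is `V`, and by invariance `π ∘ A j` depends only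
  -- on `π v`, so `π (x t)` obeys a closed linear integral inequality.
  let π : (Fin n → ℝ) →L[ℝ] (Fin n → ℝ) :=
    (W.projection V hW.symm).toContinuousLinearMap
  have hπ0 : ∀ v, π v = 0 ↔ v ∈ V := fun v => by simp [π]
  have hππ : ∀ v, v - π v ∈ V := fun v => by
    rw [← hπ0, map_sub, sub_eq_zero]
    exact (Submodule.projection_apply_of_mem_left hW.symm
      (Submodule.projection_apply_mem hW.symm v)).symm
  obtain ⟨K₁, hK₁, hK₁'⟩ := exists_mulVec_bound S.A
  set K := ‖π‖ * K₁ with hK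
  have hK0 : 0 ≤ K := by positivity
  have hbd : ∀ j v, ‖π (S.A j *ᵥ v)‖ ≤ K * ‖π v‖ := fun j v => by
    have h1 : π (S.A j *ᵥ v) = π (S.A j *ᵥ π v) := by
      rw [← sub_eq_zero, ← map_sub, ← Matrix.mulVec_sub, hπ0]
      exact hA j _ (hππ v)
    rw [h1, hK, mul_assoc]
    exact (π.le_opNorm _).trans (mul_le_mul_of_nonneg_left (hK₁' j _) (norm_nonneg _))
  have heq : ∀ t ∈ Icc 0 T, π (x t) = ∫ s in (0 : ℝ)..t, π (S.A (q s) *ᵥ x s) := by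
    intro t ht
    have h0 : (0 : ℝ) ∈ Icc 0 T := ⟨le_rfl, ht.1.trans ht.2⟩
    rw [hx.2 t ht, map_add, (hπ0 x₀).2 hx₀, zero_add,
      ← π.intervalIntegral_comp_comm (S.intervalIntegrable_field hq hu hx.1 h0 ht)]
    congr 1
    ext1 s
    rw [map_add, (hπ0 _).2 (hB s), add_zero]
  obtain ⟨c, hc⟩ := isCompact_Icc.exists_bound_of_continuousOn (π.continuous.comp_continuousOn hx.1)
  -- Feeding the bound back into the integral equation gains one power over a factorial each time;
  -- the limit in `k` is zero.
  have hiter : ∀ k : ℕ, ∀ t ∈ Icc 0 T, ‖π (x t)‖ ≤ c * ((K * t) ^ k / k.factorial) := by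
    intro k
    induction k with
    | zero => intro t ht; simpa using hc t ht
    | succ k ih =>
      intro t ht
      rw [heq t ht]
      refine norm_integral_le_pow_succ ht.1 fun s hs => ?_
      exact (hbd _ _).trans (mul_le_mul_of_nonneg_left (ih s ⟨hs.1, hs.2.trans ht.2⟩) hK0)
  rw [← hπ0, ← norm_le_zero_iff]
  have hlim := (FloorSemiring.tendsto_pow_div_factorial_atTop (K * t)).const_mul c
  rw [mul_zero] at hlim
  exact ge_of_tendsto' hlim fun k => hiter k t ht

/-- Unforced trajectories are determined by their initial state. -/
lemma IsTrajectoryOn.unforced_unique {S : LSS M n m p} {x₀ : Fin n → ℝ} {q : ℝ → Fin M}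
    {x y : ℝ → Fin n → ℝ} {T : ℝ} (hq : IsSwitchingSignalOn q T)
    (hx : S.IsTrajectoryOn x₀ (fun _ => 0) q x T) (hy : S.IsTrajectoryOn x₀ (fun _ => 0) q y T)
    {t : ℝ} (ht : t ∈ Icc 0 T) : x t = y t := by
  have h := (hx.sub hq (isInputOn_const 0 T) (isInputOn_const 0 T) hy).mem_of_invariant hq
    (by simpa using isInputOn_const (0 : Fin m → ℝ) T) (V := ⊥) (by simp) (by simp) (by simp) ht
  simpa [sub_eq_zero] using h

/-- The part of a trajectory after time `τ` is a trajectory. -/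
lemma IsTrajectoryOn.shift {S : LSS M n m p} {x₀ : Fin n → ℝ} {u : ℝ → Fin m → ℝ}
    {q : ℝ → Fin M} {x : ℝ → Fin n → ℝ} {T τ : ℝ} (hτ : 0 ≤ τ)
    (hq : IsSwitchingSignalOn q (τ + T)) (hu : IsInputOn u (τ + T))
    (hx : S.IsTrajectoryOn x₀ u q x (τ + T)) :
    S.IsTrajectoryOn (x τ) (fun s => u (τ + s)) (fun s => q (τ + s)) (fun s => x (τ + s)) T := by
  refine ⟨hx.1.comp (by fun_prop) fun s hs => ⟨by linarith [hs.1], by linarith [hs.2]⟩,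
    fun t ht => ?_⟩
  have h0 : (0 : ℝ) ∈ Icc 0 (τ + T) := ⟨le_rfl, by linarith [ht.1, ht.2]⟩
  have h1 : τ ∈ Icc 0 (τ + T) := ⟨hτ, by linarith [ht.1, ht.2]⟩
  have h2 : τ + t ∈ Icc 0 (τ + T) := ⟨by linarith [ht.1], by linarith [ht.2]⟩
  rw [intervalIntegral.integral_comp_add_left
    (fun s => S.A (q s) *ᵥ x s + S.B (q s) *ᵥ u s) τ, add_zero]
  beta_reduce
  rw [hx.2 _ h2, hx.2 _ h1, add_assoc,
    intervalIntegral.integral_add_adjacent_intervals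
      (S.intervalIntegrable_field hq hu hx.1 h0 h1) (S.intervalIntegrable_field hq hu hx.1 h1 h2)]

/-- Endpoints are null for the integral, so input and signal need agree only on the open interval.
This matters because `concatAt T` already takes the second piece's value at `T`. -/
lemma IsTrajectoryOn.congr {S : LSS M n m p} {x₀ : Fin n → ℝ} {u u' : ℝ → Fin m → ℝ}
    {q q' : ℝ → Fin M} {x x' : ℝ → Fin n → ℝ} {T : ℝ} (h : S.IsTrajectoryOn x₀ u q x T)
    (hu : ∀ s ∈ Ioo 0 T, u' s = u s) (hq : ∀ s ∈ Ioo 0 T, q' s = q s)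
    (hx : ∀ s ∈ Icc 0 T, x' s = x s) : S.IsTrajectoryOn x₀ u' q' x' T := by
  refine ⟨h.1.congr hx, fun t ht => ?_⟩
  rw [hx t ht, h.2 t ht]
  congr 1
  rw [intervalIntegral.integral_of_le ht.1, intervalIntegral.integral_of_le ht.1,
    integral_Ioc_eq_integral_Ioo, integral_Ioc_eq_integral_Ioo]
  refine setIntegral_congr_fun measurableSet_Ioo fun s hs => ?_
  have hs' : s ∈ Ioo 0 T := ⟨hs.1, hs.2.trans_le ht.2⟩
  simp only [hu s hs', hq s hs', hx s (Ioo_subset_Icc_self hs')]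

/-- Concatenation of trajectories. -/
lemma IsTrajectoryOn.concatAt {S : LSS M n m p} {x₀ : Fin n → ℝ} {u v : ℝ → Fin m → ℝ}
    {q r : ℝ → Fin M} {x y : ℝ → Fin n → ℝ} {T τ : ℝ} (hT : 0 ≤ T) (hτ : 0 ≤ τ)
    (hq : IsSwitchingSignalOn q T) (hr : IsSwitchingSignalOn r τ) (hu : IsInputOn u T)
    (hv : IsInputOn v τ) (hx : S.IsTrajectoryOn x₀ u q x T)
    (hy : S.IsTrajectoryOn (x T) v r y τ) :
    S.IsTrajectoryOn x₀ (concatAt T u v) (concatAt T q r) (concatAt T x y) (T + τ) := by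
  have hy0 : y 0 = x T := hy.apply_zero hτ
  have hxle : ∀ s ≤ T, _root_.concatAt T x y s = x s := fun s hs => by
    rcases hs.lt_or_eq with h | rfl
    · exact concatAt_of_lt _ _ h
    · rw [concatAt_of_le _ _ le_rfl, sub_self, hy0]
  have hfirst : S.IsTrajectoryOn x₀ (_root_.concatAt T u v) (_root_.concatAt T q r)
      (_root_.concatAt T x y) T :=
    hx.congr (fun s hs => concatAt_of_lt _ _ hs.2) (fun s hs => concatAt_of_lt _ _ hs.2)
      fun s hs => hxle s hs.2
  have hcont : ContinuousOn (_root_.concatAt T x y) (Icc 0 (T + τ)) := by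
    have h2 : ContinuousOn (_root_.concatAt T x y) (Icc T (T + τ)) := by
      refine ContinuousOn.congr (hy.1.comp (f := fun s => s - T) (by fun_prop) fun s hs =>
        ⟨by linarith [hs.1], by linarith [hs.2]⟩) fun s hs => concatAt_of_le _ _ hs.1
    rw [← Icc_union_Icc_eq_Icc hT (by linarith : T ≤ T + τ)]
    exact hfirst.1.union_of_isClosed h2 isClosed_Icc isClosed_Icc
  refine ⟨hcont, fun t ht => ?_⟩
  rcases le_total t T with htT | htT
  · exact hfirst.2 t ⟨ht.1, htT⟩
  have hq' := hq.concatAt hr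
  have hu' := hu.concatAt hv
  have h0 : (0 : ℝ) ∈ Icc 0 (T + τ) := ⟨le_rfl, by linarith⟩
  have h1 : T ∈ Icc 0 (T + τ) := ⟨hT, by linarith⟩
  rw [← intervalIntegral.integral_add_adjacent_intervals
    (S.intervalIntegrable_field hq' hu' hcont h0 h1)
    (S.intervalIntegrable_field hq' hu' hcont h1 ht),
    ← add_assoc, ← hfirst.2 T ⟨hT, le_rfl⟩, hxle T le_rfl, concatAt_of_le _ _ htT,
    hy.2 (t - T) ⟨by linarith, by linarith [ht.2]⟩]
  congr 1
  rw [← sub_self T, ← intervalIntegral.integral_comp_sub_right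
    (fun s => S.A (r s) *ᵥ y s + S.B (r s) *ᵥ v s) T]
  refine intervalIntegral.integral_congr fun s hs => ?_
  rw [uIcc_of_le htT] at hs
  simp only [concatAt_of_le _ _ hs.1]

/-! ### Existence of unforced trajectories by the Picard series -/

/-- The terms of the Picard series of the unforced system. -/
noncomputable def picardTerm (S : LSS M n m p) (q : ℝ → Fin M) (ξ : Fin n → ℝ) :
    ℕ → ℝ → Fin n → ℝ
  | 0 => fun _ => ξ
  | k + 1 => fun t => ∫ s in (0 : ℝ)..t, S.A (q s) *ᵥ picardTerm S q ξ k s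

lemma continuousOn_picardTerm (S : LSS M n m p) {q : ℝ → Fin M} (ξ : Fin n → ℝ) {T : ℝ}
    (hT : 0 ≤ T) (hq : IsSwitchingSignalOn q T) (k : ℕ) :
    ContinuousOn (S.picardTerm q ξ k) (Icc 0 T) := by
  induction k with
  | zero => exact continuousOn_const
  | succ k ih =>
    have h := integrableOn_mulVec hq S.A ih.integrableOn_Icc
    rw [← uIcc_of_le hT] at h ⊢
    exact intervalIntegral.continuousOn_primitive_interval h

lemma norm_picardTerm_le (S : LSS M n m p) (q : ℝ → Fin M) (ξ : Fin n → ℝ) {K : ℝ} (hK0 : 0 ≤ K)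
    (hK : ∀ j v, ‖S.A j *ᵥ v‖ ≤ K * ‖v‖) (k : ℕ) {t : ℝ} (ht : 0 ≤ t) :
    ‖S.picardTerm q ξ k t‖ ≤ ‖ξ‖ * ((K * t) ^ k / k.factorial) := by
  induction k generalizing t with
  | zero => simp [picardTerm]
  | succ k ih =>
    exact norm_integral_le_pow_succ ht fun s hs =>
      (hK _ _).trans (mul_le_mul_of_nonneg_left (ih hs.1) hK0)

/-- Existence of unforced trajectories along arbitrary switching signals. -/
lemma exists_unforced_trajectory (S : LSS M n m p) {q : ℝ → Fin M} (hq : IsSwitchingSignal q)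
    (ξ : Fin n → ℝ) : ∃ x, S.IsTrajectory ξ (fun _ => 0) q x := by
  obtain ⟨K, hK0, hK⟩ := exists_mulVec_bound S.A
  have hbd : ∀ k t, 0 ≤ t → ‖S.picardTerm q ξ k t‖ ≤ ‖ξ‖ * ((K * t) ^ k / k.factorial) :=
    fun k t ht => S.norm_picardTerm_le q ξ hK0 hK k ht
  have hsum : ∀ t, Summable fun k : ℕ => ‖ξ‖ * ((K * t) ^ k / k.factorial) := fun t =>
    (Real.summable_pow_div_factorial (K * t)).mul_left _
  refine ⟨fun t => ∑' k, S.picardTerm q ξ k t, fun T hT => ⟨?_, fun t ht => ?_⟩⟩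
  · refine continuousOn_tsum (fun k => S.continuousOn_picardTerm ξ hT (hq T hT) k) (hsum T)
      fun k t ht => (hbd k t ht.1).trans ?_
    have := ht.1
    gcongr
    exact ht.2
  · have hterm : ∀ s, 0 ≤ s → Summable fun k => S.picardTerm q ξ k s := fun s hs =>
      Summable.of_norm_bounded (hsum s) fun k => hbd k s hs
    -- Termwise integration of the series, dominated on `[0, t]` by the exponential series at `K *
    -- t`.
    have hI : HasSum (fun k => S.picardTerm q ξ (k + 1) t)
        (∫ s in (0 : ℝ)..t, S.A (q s) *ᵥ ∑' k, S.picardTerm q ξ k s) := by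
      refine intervalIntegral.hasSum_integral_of_dominated_convergence
        (fun k _ => K * (‖ξ‖ * ((K * t) ^ k / k.factorial))) (fun k => ?_) (fun k => ?_) ?_ ?_ ?_
      · rw [uIoc_of_le ht.1]
        exact ((integrableOn_mulVec (hq T hT) S.A
          (S.continuousOn_picardTerm ξ hT (hq T hT) k).integrableOn_Icc).mono_set
          ((Ioc_subset_Icc_self).trans (Icc_subset_Icc_right ht.2))).aestronglyMeasurable
      · refine Filter.Eventually.of_forall fun s hs => ?_
        rw [uIoc_of_le ht.1] at hs
        refine (hK _ _).trans (mul_le_mul_of_nonneg_left ((hbd k s hs.1.le).trans ?_) hK0)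
        have := hs.1.le
        gcongr
        exact hs.2
      · exact Filter.Eventually.of_forall fun s _ => (hsum t).mul_left K
      · exact intervalIntegrable_const
      · refine Filter.Eventually.of_forall fun s hs => ?_
        rw [uIoc_of_le ht.1] at hs
        exact (hterm s hs.1.le).hasSum.mapL (S.A (q s)).mulVecLin.toContinuousLinearMap
    simp only [Matrix.mulVec_zero, add_zero]
    rw [← hI.tsum_eq, (hterm t ht.1).tsum_eq_zero_add]
    rfl

/-! ### Flow of a single mode and its response to constant inputs -/

/-- The flow `exp (t Aⱼ)` of the mode `j`. -/
noncomputable def modeFlow (S : LSS M n m p) (j : Fin M) (t : ℝ) :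
    (Fin n → ℝ) →L[ℝ] (Fin n → ℝ) :=
  NormedSpace.exp (t • (S.A j).mulVecLin.toContinuousLinearMap)

lemma modeFlow_zero (S : LSS M n m p) (j : Fin M) : S.modeFlow j 0 = 1 := by
  simp [modeFlow, NormedSpace.exp_zero]

lemma modeFlow_apply_neg (S : LSS M n m p) (j : Fin M) (t : ℝ) (v : Fin n → ℝ) :
    S.modeFlow j t (S.modeFlow j (-t) v) = v := by
  have h : S.modeFlow j t * S.modeFlow j (-t) = 1 := by
    have hball : ∀ f : (Fin n → ℝ) →L[ℝ] (Fin n → ℝ),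
        f ∈ Metric.eball 0 (NormedSpace.expSeries ℝ ((Fin n → ℝ) →L[ℝ] (Fin n → ℝ))).radius :=
      fun f => (NormedSpace.expSeries_radius_eq_top ℝ ((Fin n → ℝ) →L[ℝ] (Fin n → ℝ))).symm ▸
        edist_lt_top _ _
    rw [modeFlow, modeFlow, ← NormedSpace.exp_add_of_commute_of_mem_ball (𝕂 := ℝ)
      (((Commute.refl _).smul_left _).smul_right _) (hball _) (hball _), ← add_smul, add_neg_cancel,
      zero_smul, NormedSpace.exp_zero]
  exact congrArg (fun f => f v) h

lemma modeFlow_injective (S : LSS M n m p) (j : Fin M) (t : ℝ) :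
    Function.Injective (S.modeFlow j t) := fun v w h => by
  have := congrArg (S.modeFlow j (-t)) h
  have h2 : ∀ v, S.modeFlow j (-t) (S.modeFlow j t v) = v := fun v => by
    simpa using S.modeFlow_apply_neg j (-t) v
  rwa [h2, h2] at this

lemma hasDerivAt_modeFlow (S : LSS M n m p) (j : Fin M) (t : ℝ) :
    HasDerivAt (S.modeFlow j) ((S.A j).mulVecLin.toContinuousLinearMap * S.modeFlow j t) t :=
  hasDerivAt_exp_smul_const' (𝕂 := ℝ) (𝔸 := (Fin n → ℝ) →L[ℝ] (Fin n → ℝ))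
    (S.A j).mulVecLin.toContinuousLinearMap t

lemma hasDerivAt_modeFlow_zero_apply (S : LSS M n m p) (j : Fin M) (v : Fin n → ℝ) :
    HasDerivAt (fun t => S.modeFlow j t v) (S.A j *ᵥ v) 0 := by
  have h := (S.hasDerivAt_modeFlow j 0).clm_apply (hasDerivAt_const 0 v)
  simpa [modeFlow_zero] using h

lemma continuous_modeFlow (S : LSS M n m p) (j : Fin M) : Continuous (S.modeFlow j) :=
  continuous_iff_continuousAt.2 fun t => (S.hasDerivAt_modeFlow j t).continuousAt

/-- The response of the mode `j` to the constant input `v`, transported back to time `0`. -/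
noncomputable def modeResponse (S : LSS M n m p) (j : Fin M) (v : Fin m → ℝ) (t : ℝ) :
    Fin n → ℝ :=
  ∫ s in (0 : ℝ)..t, S.modeFlow j (-s) (S.B j *ᵥ v)

lemma hasDerivAt_modeResponse (S : LSS M n m p) (j : Fin M) (v : Fin m → ℝ) (t : ℝ) :
    HasDerivAt (S.modeResponse j v) (S.modeFlow j (-t) (S.B j *ᵥ v)) t := by
  have hc : Continuous fun s => S.modeFlow j (-s) (S.B j *ᵥ v) :=
    ((S.continuous_modeFlow j).comp continuous_neg).clm_apply continuous_const
  exact intervalIntegral.integral_hasDerivAt_right (hc.intervalIntegrable _ _)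
    (hc.stronglyMeasurableAtFilter _ _) hc.continuousAt

/-- Trajectories of a single mode under a constant input. -/
lemma isTrajectoryOn_mode (S : LSS M n m p) (j : Fin M) (ξ : Fin n → ℝ) (v : Fin m → ℝ) (c T : ℝ) :
    S.IsTrajectoryOn ξ (fun _ => c • v) (fun _ => j)
      (fun t => S.modeFlow j t (ξ + c • S.modeResponse j v t)) T := by
  -- Variation of constants: in the product rule the flow at `t` cancels the flow at `-t` inside the
  -- derivative of `modeResponse`.
  have hderiv : ∀ t, HasDerivAt (fun t => S.modeFlow j t (ξ + c • S.modeResponse j v t))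
      (S.A j *ᵥ S.modeFlow j t (ξ + c • S.modeResponse j v t) + S.B j *ᵥ (c • v)) t := fun t => by
    have h := (S.hasDerivAt_modeFlow j t).clm_apply
      (((S.hasDerivAt_modeResponse j v t).const_smul c).const_add ξ)
    rw [map_smul, modeFlow_apply_neg] at h
    rw [Matrix.mulVec_smul]
    exact h
  have hcont : Continuous fun t => S.modeFlow j t (ξ + c • S.modeResponse j v t) :=
    continuous_iff_continuousAt.2 fun t => (hderiv t).continuousAt
  refine ⟨hcont.continuousOn, fun t _ => ?_⟩
  have hcont' : Continuous fun t => S.A j *ᵥ S.modeFlow j t (ξ + c • S.modeResponse j v t) +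
      S.B j *ᵥ (c • v) :=
    ((S.A j).mulVecLin.toContinuousLinearMap.continuous.comp hcont).add continuous_const
  rw [intervalIntegral.integral_eq_sub_of_hasDerivAt (fun s _ => hderiv s)
    (hcont'.intervalIntegrable _ _)]
  simp [modeFlow_zero, modeResponse]

lemma isTrajectoryOn_modeFlow (S : LSS M n m p) (j : Fin M) (ξ : Fin n → ℝ) (T : ℝ) :
    S.IsTrajectoryOn ξ (fun _ => 0) (fun _ => j) (fun t => S.modeFlow j t ξ) T := by
  simpa using S.isTrajectoryOn_mode j ξ 0 0 T

end LSS

/-- If a curve lies in a subspace for nonnegative times, so does its derivative at time `0`. -/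
lemma Submodule.mem_of_hasDerivAt {n : ℕ} (V : Submodule ℝ (Fin n → ℝ)) {f : ℝ → Fin n → ℝ}
    {f' : Fin n → ℝ} (hf : HasDerivAt f f' 0) (hV : ∀ t, 0 ≤ t → f t ∈ V) : f' ∈ V := by
  have hlim := hf.tendsto_slope_zero_right
  refine V.closed_of_finiteDimensional.mem_of_tendsto hlim ?_
  filter_upwards [self_mem_nhdsWithin] with t ht
  rw [zero_add]
  exact V.smul_mem _ (V.sub_mem (hV t (le_of_lt ht)) (hV 0 le_rfl))

/-! ### Jointly reachable subspaces of maximal dimension -/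

namespace LSS

variable {M n m p : ℕ}

/-- The subspace `R` can be reached from the origin at a common time along a common switching
signal. -/
def IsJointlyReachable (S : LSS M n m p) (R : Submodule ℝ (Fin n → ℝ)) : Prop :=
  ∃ T : ℝ, 0 ≤ T ∧ ∃ q : ℝ → Fin M, IsSwitchingSignalOn q T ∧ ∀ ξ ∈ R,
    ∃ u : ℝ → Fin m → ℝ, IsInputOn u T ∧
      ∃ x : ℝ → Fin n → ℝ, S.IsTrajectoryOn 0 u q x T ∧ x T = ξ

lemma isJointlyReachable_bot [NeZero M] (S : LSS M n m p) : S.IsJointlyReachable ⊥ := by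
  refine ⟨0, le_rfl, fun _ => 0, isSwitchingSignalOn_const 0 0, fun ξ hξ => ?_⟩
  refine ⟨fun _ => 0, isInputOn_const 0 0, _, S.isTrajectoryOn_modeFlow 0 0 0, ?_⟩
  rw [map_zero, (Submodule.mem_bot ℝ).1 hξ]

lemma IsJointlyReachable.mono {S : LSS M n m p} {R R' : Submodule ℝ (Fin n → ℝ)}
    (h : S.IsJointlyReachable R) (hle : R' ≤ R) : S.IsJointlyReachable R' := by
  obtain ⟨T, hT, q, hq, hR⟩ := h
  exact ⟨T, hT, q, hq, fun ξ hξ => hR ξ (hle hξ)⟩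

/-- Appending a mode with constant inputs enlarges a jointly reachable subspace. -/
lemma IsJointlyReachable.extend {S : LSS M n m p} {R : Submodule ℝ (Fin n → ℝ)}
    (h : S.IsJointlyReachable R) (j : Fin M) (v : Fin m → ℝ) {τ : ℝ} (hτ : 0 ≤ τ) :
    S.IsJointlyReachable
      ((R ⊔ Submodule.span ℝ {S.modeResponse j v τ}).map (S.modeFlow j τ).toLinearMap) := by
  obtain ⟨T, hT, q, hq, hR⟩ := h
  refine ⟨T + τ, by linarith, _, hq.concatAt (isSwitchingSignalOn_const j τ), ?_⟩
  rintro _ ⟨η, hη, rfl⟩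
  obtain ⟨ξ, hξ, ζ, hζ, rfl⟩ := Submodule.mem_sup.1 hη
  obtain ⟨c, rfl⟩ := Submodule.mem_span_singleton.1 hζ
  obtain ⟨u, hu, x, hx, rfl⟩ := hR ξ hξ
  refine ⟨_, hu.concatAt (isInputOn_const (c • v) τ), _,
    hx.concatAt hT hτ hq (isSwitchingSignalOn_const j τ) hu (isInputOn_const (c • v) τ)
      (S.isTrajectoryOn_mode j (x T) v c τ), ?_⟩
  rw [concatAt_of_le _ _ (by linarith), add_sub_cancel_left]
  rfl

/-- There is a jointly reachable subspace which is invariant under all `Aⱼ` and contains the ranges of all `Bⱼ`. -/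
lemma exists_isJointlyReachable_invariant [NeZero M] (S : LSS M n m p) :
    ∃ V : Submodule ℝ (Fin n → ℝ), S.IsJointlyReachable V ∧
      (∀ j, ∀ v ∈ V, S.A j *ᵥ v ∈ V) ∧ ∀ j v, S.B j *ᵥ v ∈ V := by
  let IsMax : Submodule ℝ (Fin n → ℝ) → Prop := fun R => S.IsJointlyReachable R ∧
    ∀ R', S.IsJointlyReachable R' → Module.finrank ℝ R' ≤ Module.finrank ℝ R
  obtain ⟨R₀, hR₀⟩ : ∃ R, IsMax R := by
    let d : Set ℕ := {k | ∃ R, S.IsJointlyReachable R ∧ Module.finrank ℝ R = k}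
    have hne : d.Nonempty := ⟨_, ⊥, S.isJointlyReachable_bot, rfl⟩
    have hbdd : BddAbove d := ⟨Module.finrank ℝ (Fin n → ℝ), by
      rintro _ ⟨R, -, rfl⟩
      exact R.finrank_le⟩
    obtain ⟨R, hR, hk⟩ := Nat.sSup_mem hne hbdd
    exact ⟨R, hR, fun R' hR' => hk ▸ le_csSup hbdd ⟨R', hR', rfl⟩⟩
  have hfin : ∀ (j : Fin M) (τ : ℝ) (R : Submodule ℝ (Fin n → ℝ)),
      Module.finrank ℝ (R.map (S.modeFlow j τ).toLinearMap) = Module.finrank ℝ R := fun j τ R =>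
    (LinearEquiv.finrank_eq (Submodule.equivMapOfInjective _ (S.modeFlow_injective j τ) R)).symm
  -- The flow preserves dimension, so adjoining a response outside `R` would give a larger jointly
  -- reachable subspace.
  have hresp : ∀ R, IsMax R → ∀ j v τ, 0 ≤ τ → S.modeResponse j v τ ∈ R := by
    intro R hR j v τ hτ
    have h1 := hR.2 _ (hR.1.extend j v hτ)
    rw [hfin] at h1
    have h2 := Submodule.eq_of_le_of_finrank_le
      (le_sup_left : R ≤ R ⊔ Submodule.span ℝ {S.modeResponse j v τ}) h1
    rw [h2]
    exact Submodule.mem_sup_right (Submodule.mem_span_singleton_self _)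
  have hmap : ∀ R, IsMax R → ∀ j τ, 0 ≤ τ → IsMax (R.map (S.modeFlow j τ).toLinearMap) := by
    intro R hR j τ hτ
    refine ⟨(hR.1.extend j 0 hτ).mono (Submodule.map_mono le_sup_left), fun R' hR' => ?_⟩
    rw [hfin]
    exact hR.2 R' hR'
  -- Flows send maximal subspaces to maximal ones, possibly different, so all of them are
  -- intersected. If `v` lies in the image of every maximal `R` under the flow at `t`, then the flow
  -- at `-t` keeps `v` in the intersection; differentiating at `0` gives `-(S.A j *ᵥ v)`.
  refine ⟨sInf {R | IsMax R}, hR₀.1.mono (sInf_le hR₀), fun j v hv => ?_, fun j v => ?_⟩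
  · rw [← neg_mem_iff]
    have hd : HasDerivAt (fun t : ℝ => S.modeFlow j (-t) v) (-(S.A j *ᵥ v)) 0 := by
      have h : HasDerivAt (fun t => S.modeFlow j t v) (S.A j *ᵥ v) (-0) := by
        simpa using S.hasDerivAt_modeFlow_zero_apply j v
      have h' := h.scomp 0 (hasDerivAt_neg 0)
      rwa [neg_one_smul] at h'
    refine Submodule.mem_of_hasDerivAt _ hd fun t ht => ?_
    rw [Submodule.mem_sInf] at hv ⊢
    intro R hR
    obtain ⟨w, hw, hwv⟩ := hv _ (hmap R hR j t ht)
    have : w = S.modeFlow j (-t) v := by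
      apply S.modeFlow_injective j t
      rw [modeFlow_apply_neg]
      exact hwv
    exact this ▸ hw
  · rw [Submodule.mem_sInf]
    intro R hR
    have hd := S.hasDerivAt_modeResponse j v 0
    rw [neg_zero, modeFlow_zero, one_apply_eq_self] at hd
    exact R.mem_of_hasDerivAt hd fun t ht => hresp R hR j v t ht

/-! ### The reachability and observability criteria -/

lemma range_mulVecLin_eq_top_iff {P : Matrix (Fin n) (Fin n) ℝ} :
    LinearMap.range P.mulVecLin = ⊤ ↔ ∀ w, P *ᵥ w = 0 → w = 0 := by
  rw [LinearMap.range_eq_top, ← LinearMap.injective_iff_surjective, injective_iff_map_eq_zero]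
  rfl

/-- The vectors orthogonal to a given set. -/
def dotOrthogonal (U : Set (Fin n → ℝ)) : Submodule ℝ (Fin n → ℝ) where
  carrier := {η | ∀ ξ ∈ U, ξ ⬝ᵥ η = 0}
  add_mem' := fun ha hb ξ hξ => by rw [dotProduct_add, ha ξ hξ, hb ξ hξ, add_zero]
  zero_mem' := fun ξ _ => dotProduct_zero ξ
  smul_mem' := fun c a ha ξ hξ => by rw [dotProduct_smul, ha ξ hξ, smul_zero]

theorem completelyReachable_iff [NeZero M] (S : LSS M n m p) {P : Matrix (Fin n) (Fin n) ℝ}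
    (hP : IsUniquePosSemidefSolution S.ReachLyapunov P) :
    S.CompletelyReachable ↔ LinearMap.range P.mulVecLin = ⊤ := by
  rw [range_mulVecLin_eq_top_iff]
  constructor
  · intro h w hw
    have hinv := fun {w : Fin n → ℝ} (hw : P *ᵥ w = 0) (j : Fin M) =>
      ReachLyapunov.ker_invariant hP.1.1 hP.1.2 hw j
    have hwR : w ∈ S.reachableSet := by rw [show S.reachableSet = univ from h]; trivial
    obtain ⟨T, hT, q, hq, u, hu, x, hx, rfl⟩ := hwR
    -- The final state, itself in `ker P`, is also orthogonal to `ker P`, hence to itself.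
    have hmem := hx.mem_of_invariant hq hu (V := dotOrthogonal {w | P *ᵥ w = 0})
      (fun j v hv w hw => by
        rw [Matrix.dotProduct_mulVec, ← Matrix.mulVec_transpose]
        exact hv _ (hinv hw j).1)
      (fun s w hw => by
        rw [Matrix.dotProduct_mulVec, ← Matrix.mulVec_transpose, (hinv hw (q s)).2,
          zero_dotProduct])
      (Submodule.zero_mem _) ⟨hT, le_rfl⟩
    exact dotProduct_self_eq_zero.1 (hmem _ hw)
  · intro hker
    obtain ⟨V, hV, hA, hB⟩ := S.exists_isJointlyReachable_invariant
    obtain ⟨T, hT, q, hq, hreach⟩ := hV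
    refine eq_univ_of_forall fun ξ => ⟨T, hT, q, hq, hreach ξ ?_⟩
    rw [eq_top_of_invariant hP hker V hA hB]
    trivial

/-- Both trajectories share input and signal, so their difference is unforced: the choice of input
plays no role in unobservability. -/
lemma exists_unforced_of_mem_unobservableSet {S : LSS M n m p} {ξ : Fin n → ℝ}
    (hξ : ξ ∈ S.unobservableSet) {q : ℝ → Fin M} (hq : IsSwitchingSignal q) :
    ∃ x, S.IsTrajectory ξ (fun _ => 0) q x ∧ ∀ t, 0 ≤ t → S.C (q t) *ᵥ x t = 0 := by
  obtain ⟨u, hu, x, z, hx, hz, hy⟩ := hξ q hq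
  refine ⟨fun t => x t - z t, fun T hT => ?_, fun t ht => ?_⟩
  · simpa using (hx T hT).sub (hq T hT) (hu T hT) (hu T hT) (hz T hT)
  · rw [Matrix.mulVec_sub, hy t ht, sub_self]

lemma mem_unobservableSet_of_unforced {S : LSS M n m p} {ξ : Fin n → ℝ}
    (h : ∀ q : ℝ → Fin M, IsSwitchingSignal q → ∃ x, S.IsTrajectory ξ (fun _ => 0) q x ∧
      ∀ t, 0 ≤ t → S.C (q t) *ᵥ x t = 0) : ξ ∈ S.unobservableSet := by
  intro q hq
  obtain ⟨x, hx, hy⟩ := h q hq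
  refine ⟨fun _ => 0, fun T _ => isInputOn_const 0 T, x, fun _ => 0, hx, fun T _ => ?_,
    fun t ht => by simp [hy t ht]⟩
  exact ⟨continuousOn_const, fun t _ => by simp⟩

lemma mulVec_eq_zero_of_mem_unobservableSet {S : LSS M n m p} {ξ : Fin n → ℝ}
    (hξ : ξ ∈ S.unobservableSet) (j : Fin M) : S.C j *ᵥ ξ = 0 := by
  obtain ⟨x, hx, hy⟩ := exists_unforced_of_mem_unobservableSet hξ
    (q := fun _ => j) fun T _ => isSwitchingSignalOn_const j T
  rw [← (hx 0 le_rfl).apply_zero le_rfl]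
  exact hy 0 le_rfl

/-- To test the flowed state against `q`, test `ξ` against the signal that holds mode `j` for time
`τ` and then runs `q`. By uniqueness that trajectory passes through the flowed state at `τ`, and its
tail has zero output. -/
lemma modeFlow_mem_unobservableSet {S : LSS M n m p} {ξ : Fin n → ℝ}
    (hξ : ξ ∈ S.unobservableSet) (j : Fin M) {τ : ℝ} (hτ : 0 ≤ τ) :
    S.modeFlow j τ ξ ∈ S.unobservableSet := by
  refine mem_unobservableSet_of_unforced fun q hq => ?_
  have hc : IsSwitchingSignal (concatAt τ (fun _ => j) q) := fun T hT =>
    ((isSwitchingSignalOn_const j τ).concatAt (hq T hT)).mono (by linarith)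
  obtain ⟨x, hx, hy⟩ := exists_unforced_of_mem_unobservableSet hξ hc
  have hxτ : x τ = S.modeFlow j τ ξ := by
    refine ((hx τ hτ).congr (q' := fun _ => j) (fun _ _ => rfl)
      (fun s hs => (concatAt_of_lt (fun _ => j) q hs.2).symm) fun _ _ => rfl).unforced_unique
      (isSwitchingSignalOn_const j τ) (S.isTrajectoryOn_modeFlow j ξ τ) ⟨hτ, le_rfl⟩
  have hq' : ∀ s, 0 ≤ s → concatAt τ (fun _ => j) q (τ + s) = q s := fun s hs => by
    rw [concatAt_of_le _ _ (by linarith), add_sub_cancel_left]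
  refine ⟨fun s => x (τ + s), fun T hT => ?_, fun t ht => ?_⟩
  · have h := (hx (τ + T) (by linarith)).shift hτ (hc _ (by linarith)) (isInputOn_const 0 _)
    rw [hxτ] at h
    exact h.congr (fun _ _ => rfl) (fun s hs => (hq' s hs.1.le).symm) fun _ _ => rfl
  · have h := hy (τ + t) (by linarith)
    rwa [hq' t ht] at h

theorem completelyObservable_iff [NeZero M] (S : LSS M n m p) {Q : Matrix (Fin n) (Fin n) ℝ}
    (hQ : IsUniquePosSemidefSolution S.ObsLyapunov Q) :
    S.CompletelyObservable ↔ LinearMap.range Q.mulVecLin = ⊤ := by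
  have hQ' : IsUniquePosSemidefSolution S.dual.ReachLyapunov Q :=
    ⟨⟨hQ.1.1, (S.obsLyapunov_iff_dual Q).1 hQ.1.2⟩,
      fun X hX hE => hQ.2 X hX ((S.obsLyapunov_iff_dual X).2 hE)⟩
  rw [range_mulVecLin_eq_top_iff]
  constructor
  · intro h w hw
    have hinv : ∀ w, Q *ᵥ w = 0 → ∀ j, Q *ᵥ (S.A j *ᵥ w) = 0 ∧ S.C j *ᵥ w = 0 := fun w hw j => by
      simpa [dual] using ReachLyapunov.ker_invariant hQ'.1.1 hQ'.1.2 hw j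
    have hwU : w ∈ S.unobservableSet := by
      refine mem_unobservableSet_of_unforced fun q hq => ?_
      obtain ⟨x, hx⟩ := S.exists_unforced_trajectory hq w
      refine ⟨x, hx, fun t ht => (hinv _ ?_ _).2⟩
      exact (hx t ht).mem_of_invariant (hq t ht) (isInputOn_const 0 t)
        (V := LinearMap.ker Q.mulVecLin) (fun j v hv => (hinv v hv j).1) (by simp) hw ⟨ht, le_rfl⟩
    have hwO : w ∈ S.observableSet := by rw [show S.observableSet = univ from h]; trivial
    exact dotProduct_self_eq_zero.1 (hwO w hwU)
  · intro hker
    -- The orthogonal complement is a subspace whether or not the unobservable set is one. Its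
    -- invariance under `(S.A j)ᵀ` comes from differentiating at `0` the flow of an unobservable
    -- state, which stays in the hyperplane (or whole space) orthogonal to `η`.
    have htop := eq_top_of_invariant hQ' hker (dotOrthogonal S.unobservableSet)
      (fun j η hη ξ hξ => by
        have hd := S.hasDerivAt_modeFlow_zero_apply j ξ
        have hmem := (dotOrthogonal {η}).mem_of_hasDerivAt hd fun t ht => by
          rintro _ rfl
          rw [dotProduct_comm]
          exact hη _ (modeFlow_mem_unobservableSet hξ j ht)
        rw [Matrix.dotProduct_mulVec, dual, Matrix.vecMul_transpose, dotProduct_comm]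
        exact hmem η rfl)
      (fun j v ξ hξ => by
        rw [Matrix.dotProduct_mulVec, dual, Matrix.vecMul_transpose,
          mulVec_eq_zero_of_mem_unobservableSet hξ j, zero_dotProduct])
    refine eq_univ_of_forall fun η => ?_
    have : η ∈ dotOrthogonal S.unobservableSet := htop ▸ Submodule.mem_top
    exact this

end LSS

theorem corollary1 {M n m p : ℕ} [NeZero M] (S : LSS M n m p)
    (hA : ∀ j : Fin M, IsHurwitz (S.A j))
    (P Q : Matrix (Fin n) (Fin n) ℝ)
    (hP : IsUniquePosSemidefSolution S.ReachLyapunov P)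
    (hQ : IsUniquePosSemidefSolution S.ObsLyapunov Q) :
    (S.CompletelyReachable ↔ LinearMap.range P.mulVecLin = ⊤) ∧
      (S.CompletelyObservable ↔ LinearMap.range Q.mulVecLin = ⊤) :=
  ⟨S.completelyReachable_iff hP, S.completelyObservable_iff hQ⟩
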